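/- Let $d\ge 1$, $\tau>0$, $r_0>0$ and $c\in\mathbb{R}^d$. For a Borel probability measure $\rho$ on $\mathbb{R}^d$ put $$\mathrm{TV}(\rho)=\sup\Big\{\int_{\mathbb{R}^d}\operatorname{div} z\,d\rho \;:\; z\in C^1_c(\mathbb{R}^d;\mathbb{R}^d),\ |z(x)|\le 1 \text{ for all } x\Big\}\in[0,\infty],$$ and for Borel probability measures $\mu,\nu$ on $\mathbb{R}^d$ put $$W_2^2(\mu,\nu)=\inf_{\gamma\in\Pi(\mu,\nu)}\int_{\mathbb{R}^d\times\mathbb{R}^d}|x-y|^2\,d\gamma(x,y)\in[0,\infty],$$ where $\Pi(\mu,\nu)$ is the set of measures on $\mathbb{R}^d\times\mathbb{R}^d$ with marginals $\mu$ and $\nu$. For $r>0$ let $\rho_{r}$ be the uniform probability measure on the ball $B(c,r)$, that is, the measure with density $|B(c,r)|^{-1}\mathbf 1_{B(c,r)}$. Then the equation $$r_1^2\,(r_1-r_0)=(d+2)\,\tau$$ has exactly one positive root $r_1$, and $\rho_{r_1}$ is the unique minimizer of $$\rho\mapsto \mathrm{TV}(\rho)+\frac1{2\tau}W_2^2(\rho_{r_0},\rho)$$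 over all Borel probability measures $\rho$ on $\mathbb{R}^d$. Moreover, the dilation $T(x)=c+\frac{r_1}{r_0}(x-c)$ is an optimal transport map from $\rho_{r_0}$ to $\rho_{r_1}$: $T_\sharp\rho_{r_0}=\rho_{r_1}$ and $W_2^2(\rho_{r_0},\rho_{r_1})=\int|x-T(x)|^2\,d\rho_{r_0}(x)$. -/

import Mathlib

open MeasureTheory ProbabilityTheory
open scoped ENNReal

namespace TVWasserstein

/-- Divergence of a vector field on `ℝ^d`. -/
noncomputable def div {d : ℕ} (z : EuclideanSpace ℝ (Fin d) → EuclideanSpace ℝ (Fin d))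
    (x : EuclideanSpace ℝ (Fin d)) : ℝ :=
  ∑ i : Fin d, (fderiv ℝ z x (EuclideanSpace.single i 1)) i

/-- Total variation functional of a finite measure on `ℝ^d`: the supremum of `∫ div z dρ` over
compactly supported `C¹` fields with Euclidean sup norm at most one. As `z = 0` is admissible, the
supremum is nonnegative, so truncating each integral at zero does not change it. -/
noncomputable def TV {d : ℕ} (ρ : Measure (EuclideanSpace ℝ (Fin d))) : ℝ≥0∞ :=
  ⨆ (z : EuclideanSpace ℝ (Fin d) → EuclideanSpace ℝ (Fin d))
    (_ : ContDiff ℝ 1 z ∧ HasCompactSupport z ∧ ∀ x, ‖z x‖ ≤ 1),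
    ENNReal.ofReal (∫ x, div z x ∂ρ)

/-- Squared 2-Wasserstein distance: the optimal quadratic cost over all transport plans, with
value `∞` allowed. -/
noncomputable def W2sq {d : ℕ} (μ ν : Measure (EuclideanSpace ℝ (Fin d))) : ℝ≥0∞ :=
  ⨅ (γ : Measure (EuclideanSpace ℝ (Fin d) × EuclideanSpace ℝ (Fin d)))
    (_ : γ.map Prod.fst = μ ∧ γ.map Prod.snd = ν),
    ∫⁻ p, ‖p.1 - p.2‖ₑ ^ 2 ∂γ

/-- The TV-Wasserstein energy `TV(ρ) + W₂²(ρ₀, ρ) / (2τ)`. -/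
noncomputable def energy {d : ℕ} (τ : ℝ) (ρ₀ ρ : Measure (EuclideanSpace ℝ (Fin d))) : ℝ≥0∞ :=
  TV ρ + ENNReal.ofReal (1 / (2 * τ)) * W2sq ρ₀ ρ

/-- `ρ` minimizes the TV-Wasserstein energy among all Borel probability measures on `ℝ^d`. -/
def IsMinimizer {d : ℕ} (τ : ℝ) (ρ₀ ρ : Measure (EuclideanSpace ℝ (Fin d))) : Prop :=
  IsProbabilityMeasure ρ ∧
    ∀ σ : Measure (EuclideanSpace ℝ (Fin d)), IsProbabilityMeasure σ →
      energy τ ρ₀ ρ ≤ energy τ ρ₀ σ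

/-- Uniform probability measure on the ball `B(c, r)`: Lebesgue measure restricted to the ball,
divided by the volume of the ball. -/
noncomputable def uniformBall {d : ℕ} (c : EuclideanSpace ℝ (Fin d)) (r : ℝ) :
    Measure (EuclideanSpace ℝ (Fin d)) :=
  (volume (Metric.ball c r))⁻¹ • volume.restrict (Metric.ball c r)

end TVWasserstein

/-!
The proof is a calibration argument. Write `R = r₁²` and `T` for the dilation by `r₁ / r₀`.

The candidate `T` is the gradient of a quadratic function, so its Kantorovich potentials are
quadratic and `|x - y|² / (2τ)` equals a potential in `x`, plus `(1 - r₀/r₁) |y - c|² / (2τ)`, plus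
the square `r₀ / (2τ r₁) |y - T x|²`. On the other side, the total variation is bounded below by
the integral of the divergence of any admissible field. The field
`z(y) = F(|y - c|²) (y - c)` with `F(s) = (3R - s) / (2r₁³)` has divergence
`(3dR - (d + 2) |y - c|²) / (2r₁³)`, its radial component increases to the value one on the sphere
of radius `r₁` and is critical there, and the equation for `r₁` says exactly that the quadratic
parts of the two bounds cancel. Beyond the sphere `F` is continued by `(5R - s)² / (16r₁⁵)` up to
`s = 5R` and by zero from there on. This makes `z` a compactly supported `C¹` field with `|z| ≤ 1`
whose divergence is everywhere at least the above quadratic function (`norm_calibration_le_one`,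
`le_div_calibration`).

Summing the two bounds (`minEnergy_add_deviation_le`), for every plan `γ` from the uniform measure
on the ball of radius `r₀` to `σ`, the total variation of `σ` plus the cost of `γ` is at least a
constant plus a positive multiple of `∫ |y - T x|² dγ`. The constant is the energy of the uniform
measure on the ball of radius `r₁`: its second moment is explicit, the plan induced by `T` bounds
its transport cost, and its total variation is at most `d / r₁` by a first-order comparison of
volumes (`setIntegral_div_ball_le`), which replaces the divergence theorem on a ball. If `σ` is
another minimizer, then `∫ |y - T x|² dγ` is arbitrarily small along almost optimal plans, and
`σ` is the image of the initial measure under `T` (`map_eq_of_forall_exists_plan`). No existence of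
optimal plans is used.
-/

namespace TVWasserstein

open Filter Topology Metric Set

variable {d : ℕ}

/-! ### Divergence and the total variation of a ball -/

/-- The determinant of endomorphisms is differentiable at the identity, with the trace as its
derivative. -/
theorem exists_hasFDerivAt_det_one (d : ℕ) :
    ∃ D : (EuclideanSpace ℝ (Fin d) →L[ℝ] EuclideanSpace ℝ (Fin d)) →L[ℝ] ℝ,
      HasFDerivAt (fun A : EuclideanSpace ℝ (Fin d) →L[ℝ] EuclideanSpace ℝ (Fin d) => A.det) D 1 ∧
      ∀ A, D A = ∑ i : Fin d, (A (EuclideanSpace.single i 1)) i := by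
  set b := (EuclideanSpace.basisFun (Fin d) ℝ).toBasis with hb
  have hentry (A : EuclideanSpace ℝ (Fin d) →L[ℝ] EuclideanSpace ℝ (Fin d)) (i j : Fin d) :
      LinearMap.toMatrix b b (A : EuclideanSpace ℝ (Fin d) →ₗ[ℝ] EuclideanSpace ℝ (Fin d)) i j
        = (A (EuclideanSpace.single j 1)) i := by
    simp [LinearMap.toMatrix_apply, hb]
  have hdet (A : EuclideanSpace ℝ (Fin d) →L[ℝ] EuclideanSpace ℝ (Fin d)) :
      A.det = (LinearMap.toMatrix b b (A : EuclideanSpace ℝ (Fin d) →ₗ[ℝ] _)).det := by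
    rw [LinearMap.det_toMatrix]
  have hdiff : Differentiable ℝ
      (fun A : EuclideanSpace ℝ (Fin d) →L[ℝ] EuclideanSpace ℝ (Fin d) => A.det) := by
    simp_rw [hdet, Matrix.det_apply, hentry]
    fun_prop
  refine ⟨_, (hdiff 1).hasFDerivAt, fun A => ?_⟩
  -- The derivative in the direction `A` is read off from the expansion of `det (1 + t A)`.
  have h1 : HasDerivAt (fun t : ℝ => (1 + t • A).det)
      (fderiv ℝ (fun A : EuclideanSpace ℝ (Fin d) →L[ℝ] EuclideanSpace ℝ (Fin d) => A.det) 1 A)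
      0 := (hdiff 1).hasFDerivAt.hasLineDerivAt A
  set M := LinearMap.toMatrix b b (A : EuclideanSpace ℝ (Fin d) →ₗ[ℝ] EuclideanSpace ℝ (Fin d))
    with hM
  have h2 : HasDerivAt (fun t : ℝ => (1 + t • A).det) M.trace 0 := by
    have he : (fun t : ℝ => (1 + t • A).det) = fun t : ℝ => 1 + M.trace * t +
        (Matrix.det (1 + (Polynomial.X : Polynomial ℝ) • M.map Polynomial.C)).divX.divX.eval t
          * t ^ 2 := by
      funext t
      rw [hdet, ← Matrix.det_one_add_smul]
      congr 1
      ext i j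
      simp [hM, hb, LinearMap.toMatrix_apply, Matrix.one_apply, PiLp.single_apply]
    rw [he]
    have := (((hasDerivAt_id (0 : ℝ)).const_mul M.trace).const_add 1).add
      ((Polynomial.hasDerivAt
        ((Matrix.det (1 + (Polynomial.X : Polynomial ℝ) • M.map Polynomial.C)).divX.divX) 0).mul
        ((hasDerivAt_id (0 : ℝ)).pow 2))
    convert! this using 1
    simp
  rw [h1.unique h2]
  simp [Matrix.trace, hM, hentry]

theorem continuous_div {z : EuclideanSpace ℝ (Fin d) → EuclideanSpace ℝ (Fin d)}
    (hz : ContDiff ℝ 1 z) : Continuous (div z) := by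
  have := hz.continuous_fderiv one_ne_zero
  unfold div
  fun_prop

theorem hasCompactSupport_div {z : EuclideanSpace ℝ (Fin d) → EuclideanSpace ℝ (Fin d)}
    (hz : HasCompactSupport z) : HasCompactSupport (div z) := by
  refine (hz.fderiv ℝ).mono' (fun x hx => subset_tsupport _ ?_)
  rw [Function.mem_support] at hx ⊢
  contrapose! hx
  simp [div, hx]

theorem integrable_div {z : EuclideanSpace ℝ (Fin d) → EuclideanSpace ℝ (Fin d)}
    (hz : ContDiff ℝ 1 z) (hc : HasCompactSupport z) (μ : Measure (EuclideanSpace ℝ (Fin d)))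
    [IsFiniteMeasure μ] : Integrable (div z) μ :=
  (continuous_div hz).integrable_of_hasCompactSupport (hasCompactSupport_div hc)

/-- The flux of a field bounded by one through a sphere is at most the area of the sphere. It is
obtained by comparing, to first order in `t`, the volume of the image of the ball under
`x ↦ x + t z(x)` with the volume of the ball of radius `r + t`, which contains that image. -/
theorem setIntegral_div_ball_le {z : EuclideanSpace ℝ (Fin d) → EuclideanSpace ℝ (Fin d)}
    (hz : ContDiff ℝ 1 z) (hc : HasCompactSupport z) (hz1 : ∀ x, ‖z x‖ ≤ 1)
    (c : EuclideanSpace ℝ (Fin d)) {r : ℝ} (hr : 0 < r) :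
    ∫ x in ball c r, div z x ≤ d / r * volume.real (ball c r) := by
  obtain ⟨D, hD, hDdiv⟩ := exists_hasFDerivAt_det_one d
  obtain ⟨C, hC⟩ := (hc.fderiv ℝ).exists_bound_of_continuous (hz.continuous_fderiv one_ne_zero)
  set K := max C 1 with hK
  have hK0 : 0 < K := lt_of_lt_of_le one_pos (le_max_right _ _)
  have hCK (x) : ‖fderiv ℝ z x‖ ≤ K := (hC x).trans (le_max_left _ _)
  have hlip (x y) : ‖z x - z y‖ ≤ K * ‖x - y‖ :=
    Convex.norm_image_sub_le_of_norm_fderiv_le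
      (fun x _ => (hz.differentiable one_ne_zero) x) (fun x _ => hCK x) convex_univ
      (mem_univ y) (mem_univ x)
  set V := volume.real (ball c r) with hV
  set I := ∫ x in ball c r, div z x with hI
  have hfin : IsFiniteMeasure (volume.restrict (ball c r)) :=
    isFiniteMeasure_restrict.2 measure_ball_lt_top.ne
  have hball (t : ℝ) (ht : 0 < t) : volume.real (ball c (r + t)) = V * (1 + t / r) ^ d := by
    rw [hV, measureReal_def, measureReal_def, Measure.addHaar_ball_of_pos _ _ hr,
      Measure.addHaar_ball_of_pos _ _ (by positivity), finrank_euclideanSpace_fin,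
      ENNReal.toReal_mul, ENNReal.toReal_mul, ENNReal.toReal_ofReal (by positivity),
      ENNReal.toReal_ofReal (by positivity)]
    have : r + t = r * (1 + t / r) := by field_simp
    rw [this, mul_pow]; ring
  have key (ε : ℝ) (hε : 0 < ε) : I - ε * K * V ≤ V * (d / r) := by
    have ho := (hasFDerivAt_iff_isLittleO_nhds_zero.1 hD).def hε
    obtain ⟨δ, hδ, hball'⟩ := Metric.eventually_nhds_iff.1 ho
    have hstep : ∀ᶠ t in 𝓝[>] (0 : ℝ), I - ε * K * V ≤ V * (t⁻¹ * ((1 + t / r) ^ d - 1)) := by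
      have e1 : ∀ᶠ t in 𝓝[>] (0 : ℝ), t < δ / K :=
        nhdsWithin_le_nhds (eventually_lt_nhds (by positivity))
      have e2 : ∀ᶠ t in 𝓝[>] (0 : ℝ), t < 1 / K :=
        nhdsWithin_le_nhds (eventually_lt_nhds (by positivity))
      filter_upwards [e1, e2, self_mem_nhdsWithin] with t ht1 ht2 ht0
      have ht0 : 0 < t := ht0
      rw [lt_div_iff₀ hK0] at ht1 ht2
      have hderiv (x) : HasFDerivAt (fun x => x + t • z x) (1 + t • fderiv ℝ z x) x :=
        (hasFDerivAt_id x).add (((hz.differentiable one_ne_zero) x).hasFDerivAt.const_smul t)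
      -- `t z` is a strict contraction, so its perturbation of the identity is injective.
      have hinj : InjOn (fun x => x + t • z x) (ball c r) := by
        intro x _ y _ hxy
        by_contra hne
        have hpos : 0 < ‖x - y‖ := norm_pos_iff.2 (sub_ne_zero.2 hne)
        have h : x - y = t • z y - t • z x := by
          rw [sub_eq_sub_iff_add_eq_add, add_comm (t • z y)]
          exact hxy
        have h' : ‖x - y‖ = t * ‖z y - z x‖ := by
          rw [h, ← smul_sub, norm_smul, Real.norm_of_nonneg ht0.le]
        rw [norm_sub_rev (z y)] at h'
        nlinarith [hlip x y]
      -- The first-order expansion of the determinant is uniform in `x`, as `fderiv ℝ z` is bounded.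
      have hdet (x) : 1 + t * div z x - t * (ε * K) ≤ |(1 + t • fderiv ℝ z x).det| := by
        have hn : ‖t • fderiv ℝ z x‖ ≤ t * K := by
          rw [norm_smul, Real.norm_of_nonneg ht0.le]
          exact mul_le_mul_of_nonneg_left (hCK x) ht0.le
        have h := hball' (y := t • fderiv ℝ z x) (by rw [dist_zero_right]; linarith)
        have hone : (1 : EuclideanSpace ℝ (Fin d) →L[ℝ] EuclideanSpace ℝ (Fin d)).det = 1 :=
          LinearMap.det_id
        rw [map_smul, hDdiv, hone, Real.norm_eq_abs, smul_eq_mul] at h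
        have h := (abs_le.1 h).1
        have h3 : ε * ‖t • fderiv ℝ z x‖ ≤ ε * (t * K) := mul_le_mul_of_nonneg_left hn hε.le
        have h4 := le_abs_self ((1 + t • fderiv ℝ z x).det)
        change 1 + t * (∑ i : Fin d, (fderiv ℝ z x (EuclideanSpace.single i 1)) i)
          - t * (ε * K) ≤ _
        linarith
      have hcont : Continuous (fun x => |(1 + t • fderiv ℝ z x).det|) := by
        have := hz.continuous_fderiv one_ne_zero
        exact (ContinuousLinearMap.continuous_det.comp (by fun_prop)).abs
      have hint : Integrable (fun x => |(1 + t • fderiv ℝ z x).det|)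
          (volume.restrict (ball c r)) :=
        (hcont.continuousOn.integrableOn_compact (isCompact_closedBall c r)).mono_set
          ball_subset_closedBall
      have himage : ∫ x in ball c r, |(1 + t • fderiv ℝ z x).det| ≤
          volume.real (ball c (r + t)) := by
        rw [← ENNReal.ofReal_le_ofReal_iff measureReal_nonneg,
          ofReal_integral_eq_lintegral_ofReal hint (ae_of_all _ fun _ => abs_nonneg _),
          lintegral_abs_det_fderiv_eq_addHaar_image volume measurableSet_ball
            (fun x _ => (hderiv x).hasFDerivWithinAt) hinj, ofReal_measureReal]
        refine measure_mono ?_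
        rintro _ ⟨x, hx, rfl⟩
        rw [mem_ball, dist_eq_norm] at hx ⊢
        calc ‖x + t • z x - c‖ = ‖(x - c) + t • z x‖ := by congr 1; abel
          _ ≤ ‖x - c‖ + ‖t • z x‖ := norm_add_le _ _
          _ ≤ ‖x - c‖ + t := by
            rw [norm_smul, Real.norm_of_nonneg ht0.le]
            nlinarith [hz1 x]
          _ < r + t := by linarith
      have hdivint := integrable_div hz hc (volume.restrict (ball c r))
      have hadd : Integrable (fun x => 1 + t * div z x) (volume.restrict (ball c r)) :=
        (integrable_const _).add (hdivint.const_mul t)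
      have hcomp : ∫ x in ball c r, (1 + t * div z x - t * (ε * K)) ≤
          ∫ x in ball c r, |(1 + t • fderiv ℝ z x).det| :=
        integral_mono (hadd.sub (integrable_const _)) hint hdet
      rw [integral_sub hadd (integrable_const _),
        integral_add (integrable_const _) (hdivint.const_mul t), integral_const_mul,
        integral_const, integral_const, measureReal_restrict_apply_univ, ← hI, ← hV] at hcomp
      simp only [smul_eq_mul, mul_one] at hcomp
      rw [hball t ht0] at himage
      have h5 : t * (I - ε * K * V) ≤ V * ((1 + t / r) ^ d - 1) := by linarith
      calc I - ε * K * V = t⁻¹ * (t * (I - ε * K * V)) := by field_simp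
        _ ≤ t⁻¹ * (V * ((1 + t / r) ^ d - 1)) :=
          mul_le_mul_of_nonneg_left h5 (by positivity)
        _ = _ := by ring
    have hlim : Tendsto (fun t : ℝ => V * (t⁻¹ * ((1 + t / r) ^ d - 1))) (𝓝[>] 0)
        (𝓝 (V * (d / r))) := by
      have hd : HasDerivAt (fun t : ℝ => (1 + t / r) ^ d) (d / r) 0 := by
        have := (((hasDerivAt_id (0 : ℝ)).div_const r).const_add 1).pow d
        convert! this using 1
        simp; ring
      have := hd.tendsto_slope_zero_right
      simp only [zero_add, zero_div, add_zero, one_pow, smul_eq_mul] at this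
      exact this.const_mul V
    exact ge_of_tendsto hlim hstep
  have hlim : Tendsto (fun ε : ℝ => I - ε * K * V) (𝓝[>] 0) (𝓝 (I - 0 * K * V)) :=
    (Continuous.tendsto (by fun_prop) 0).mono_left nhdsWithin_le_nhds
  have := le_of_tendsto hlim (by filter_upwards [self_mem_nhdsWithin] with ε hε using key ε hε)
  linarith

theorem isProbabilityMeasure_uniformBall (c : EuclideanSpace ℝ (Fin d)) {r : ℝ} (hr : 0 < r) :
    IsProbabilityMeasure (uniformBall c r) :=
  cond_isProbabilityMeasure_of_finite (μ := volume) (measure_ball_pos volume c hr).ne'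
    measure_ball_lt_top.ne

theorem integral_uniformBall (c : EuclideanSpace ℝ (Fin d)) (r : ℝ)
    (f : EuclideanSpace ℝ (Fin d) → ℝ) :
    ∫ x, f x ∂(uniformBall c r) = (volume.real (ball c r))⁻¹ * ∫ x in ball c r, f x := by
  rw [uniformBall, integral_smul_measure, ENNReal.toReal_inv, smul_eq_mul, measureReal_def]

theorem TV_uniformBall_le (c : EuclideanSpace ℝ (Fin d)) {r : ℝ} (hr : 0 < r) :
    TV (uniformBall c r) ≤ ENNReal.ofReal (d / r) := by
  refine iSup₂_le fun z hz => ENNReal.ofReal_le_ofReal ?_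
  have hV : 0 < volume.real (ball c r) :=
    ENNReal.toReal_pos (measure_ball_pos volume c hr).ne' measure_ball_lt_top.ne
  rw [integral_uniformBall, inv_mul_le_iff₀ hV, mul_comm]
  exact setIntegral_div_ball_le hz.1 hz.2.1 hz.2.2 c hr

/-! ### Uniform measures on balls: second moment and dilations -/

theorem integral_uniformBall_norm_sub_sq (hd : 1 ≤ d) (c : EuclideanSpace ℝ (Fin d)) {r : ℝ}
    (hr : 0 < r) :
    ∫ x, ‖x - c‖ ^ 2 ∂(uniformBall c r) = d / (d + 2) * r ^ 2 := by
  have : Nonempty (Fin d) := ⟨⟨0, hd⟩⟩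
  have hset : ∫ x in ball c r, ‖x - c‖ ^ 2 =
      d * volume.real (ball (0 : EuclideanSpace ℝ (Fin d)) 1) * (r ^ (d + 2) / (d + 2)) := by
    calc ∫ x in ball c r, ‖x - c‖ ^ 2
        = ∫ x, (Iio r).indicator (fun t : ℝ => t ^ 2) ‖x - c‖ := by
          rw [← integral_indicator measurableSet_ball]
          refine integral_congr_ae (ae_of_all _ fun x => ?_)
          simp [indicator, mem_ball, dist_eq_norm]
      _ = ∫ x : EuclideanSpace ℝ (Fin d), (Iio r).indicator (fun t : ℝ => t ^ 2) ‖x‖ :=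
          integral_sub_right_eq_self
            (fun x : EuclideanSpace ℝ (Fin d) => (Iio r).indicator (fun t : ℝ => t ^ 2) ‖x‖) c
      _ = d * volume.real (ball (0 : EuclideanSpace ℝ (Fin d)) 1) *
          ∫ y in Ioi (0 : ℝ), y ^ (d - 1) • (Iio r).indicator (fun t : ℝ => t ^ 2) y := by
          rw [integral_fun_norm_addHaar volume, finrank_euclideanSpace_fin, nsmul_eq_mul,
            smul_eq_mul, mul_assoc]
      _ = d * volume.real (ball (0 : EuclideanSpace ℝ (Fin d)) 1) *
          ∫ y in (0 : ℝ)..r, y ^ (d + 1) := by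
          congr 1
          have h (y : ℝ) : y ^ (d - 1) • (Iio r).indicator (fun t : ℝ => t ^ 2) y =
              (Iio r).indicator (fun t : ℝ => t ^ (d + 1)) y := by
            by_cases hy : y < r
            · simp only [indicator, mem_Iio, hy, if_true, smul_eq_mul, ← pow_add]
              congr 1; omega
            · simp [indicator, hy]
          simp_rw [h]
          rw [setIntegral_indicator measurableSet_Iio, Ioi_inter_Iio,
            intervalIntegral.integral_of_le hr.le, integral_Ioc_eq_integral_Ioo]
      _ = _ := by
          rw [integral_pow]
          push_cast
          ring
  have hball : volume.real (ball c r) =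
      r ^ d * volume.real (ball (0 : EuclideanSpace ℝ (Fin d)) 1) := by
    rw [measureReal_def, Measure.addHaar_ball_of_pos _ _ hr, finrank_euclideanSpace_fin,
      ENNReal.toReal_mul, ENNReal.toReal_ofReal (by positivity), measureReal_def]
  have hV : 0 < volume.real (ball (0 : EuclideanSpace ℝ (Fin d)) 1) :=
    ENNReal.toReal_pos (measure_ball_pos volume 0 one_pos).ne' measure_ball_lt_top.ne
  rw [integral_uniformBall, hset, hball]
  field_simp
  rw [pow_add]

theorem ae_mem_ball_uniformBall (c : EuclideanSpace ℝ (Fin d)) (r : ℝ) :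
    ∀ᵐ x ∂(uniformBall c r), x ∈ ball c r := by
  have h : ∀ᵐ x ∂(volume.restrict (ball c r)), x ∈ ball c r := ae_restrict_mem measurableSet_ball
  exact Measure.ae_smul_measure h _

theorem integrable_uniformBall_norm_sub_sq (c : EuclideanSpace ℝ (Fin d)) {r : ℝ} (hr : 0 < r) :
    Integrable (fun x => ‖x - c‖ ^ 2) (uniformBall c r) := by
  have := isProbabilityMeasure_uniformBall c hr
  refine Integrable.of_bound (by fun_prop) (r ^ 2) ?_
  filter_upwards [ae_mem_ball_uniformBall c r] with x hx
  rw [mem_ball, dist_eq_norm] at hx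
  rw [Real.norm_of_nonneg (by positivity)]
  gcongr

theorem map_dilation_uniformBall (c : EuclideanSpace ℝ (Fin d)) {r s : ℝ} (hr : 0 < r)
    (hs : 0 < s) :
    (uniformBall c r).map (fun x => c + (s / r) • (x - c)) = uniformBall c s := by
  have hT : Measurable (fun x : EuclideanSpace ℝ (Fin d) => c + (s / r) • (x - c)) := by fun_prop
  have hpre (A : Set (EuclideanSpace ℝ (Fin d))) :
      (fun x => c + (s / r) • (x - c)) ⁻¹' A = AffineMap.homothety c (r / s) '' A := by
    ext x
    simp only [mem_preimage, mem_image, AffineMap.homothety_apply, vsub_eq_sub, vadd_eq_add]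
    constructor
    · intro h
      refine ⟨_, h, ?_⟩
      rw [add_sub_cancel_left, smul_smul, div_mul_div_cancel₀ hs.ne', div_self hr.ne', one_smul,
        sub_add_cancel]
    · rintro ⟨y, hy, rfl⟩
      rwa [add_sub_cancel_right, smul_smul, div_mul_div_cancel₀ hr.ne', div_self hs.ne', one_smul,
        add_sub_cancel]
  have hball : (fun x => c + (s / r) • (x - c)) ⁻¹' ball c s = ball c r := by
    ext x
    rw [mem_preimage, mem_ball, mem_ball, dist_eq_norm, dist_eq_norm, add_sub_cancel_left,
      norm_smul, Real.norm_of_nonneg (by positivity), div_mul_eq_mul_div, div_lt_iff₀ hr,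
      mul_lt_mul_iff_right₀ hs]
  ext A hA
  set k := ENNReal.ofReal |(r / s) ^ Module.finrank ℝ (EuclideanSpace ℝ (Fin d))| with hk
  have hk0 : k ≠ 0 := by
    rw [hk, Ne, ENNReal.ofReal_eq_zero, not_le]
    positivity
  have hkt : k ≠ ∞ := ENNReal.ofReal_ne_top
  rw [Measure.map_apply hT hA, uniformBall, uniformBall, Measure.smul_apply, Measure.smul_apply,
    Measure.restrict_apply hA, Measure.restrict_apply (hT hA), ← hball, ← preimage_inter, hpre,
    hpre, Measure.addHaar_image_homothety, Measure.addHaar_image_homothety, ← hk, smul_eq_mul,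
    smul_eq_mul, ENNReal.mul_inv (Or.inl hk0) (Or.inl hkt)]
  calc k⁻¹ * (volume (ball c s))⁻¹ * (k * volume (A ∩ ball c s))
      = (k⁻¹ * k) * ((volume (ball c s))⁻¹ * volume (A ∩ ball c s)) := by ring
    _ = _ := by rw [ENNReal.inv_mul_cancel hk0 hkt, one_mul]

/-! ### The calibrating vector field -/

theorem hasDerivAt_max_zero_sq (x : ℝ) :
    HasDerivAt (fun t : ℝ => max t 0 ^ 2) (2 * max x 0) x := by
  rcases lt_trichotomy x 0 with hx | rfl | hx
  · have h : (fun t : ℝ => max t 0 ^ 2) =ᶠ[𝓝 x] fun _ => 0 := by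
      filter_upwards [eventually_lt_nhds hx] with t ht
      simp [max_eq_right ht.le]
    rw [max_eq_right hx.le, mul_zero]
    exact (hasDerivAt_const x (0 : ℝ)).congr_of_eventuallyEq h
  · rw [max_self, mul_zero, hasDerivAt_iff_isLittleO]
    simp only [max_self, sub_zero, smul_zero, ne_eq, OfNat.ofNat_ne_zero, not_false_eq_true,
      zero_pow]
    refine Asymptotics.IsBigO.trans_isLittleO (g := fun t : ℝ => t ^ 2) ?_
      (Asymptotics.isLittleO_pow_id one_lt_two)
    refine Asymptotics.IsBigO.of_bound 1 (Eventually.of_forall fun t => ?_)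
    rw [Real.norm_of_nonneg (by positivity), Real.norm_of_nonneg (by positivity), one_mul]
    rcases le_total t 0 with h | h
    · rw [max_eq_right h]; nlinarith [sq_nonneg t]
    · rw [max_eq_left h]
  · have h : (fun t : ℝ => max t 0 ^ 2) =ᶠ[𝓝 x] fun t => t ^ 2 := by
      filter_upwards [eventually_gt_nhds hx] with t ht
      simp [max_eq_left ht.le]
    rw [max_eq_left hx.le]
    refine HasDerivAt.congr_of_eventuallyEq ?_ h
    simpa using hasDerivAt_pow 2 x

/-- The function `F` for which the calibrating field is `z(y) = F(|y - c|²) (y - c)`. It equals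
`(3r² - s) / (2r³)` for `s ≤ r²` and `(5r² - s)² / (16r⁵)` for `r² ≤ s ≤ 5r²`, and vanishes for
`s ≥ 5r²`; the three pieces match to first order. -/
noncomputable def profile (r s : ℝ) : ℝ :=
  1 / (2 * r ^ 3) *
    (3 * r ^ 2 - s + (max (s - r ^ 2) 0 ^ 2 - max (s - 5 * r ^ 2) 0 ^ 2) / (8 * r ^ 2))

/-- The derivative of `profile` in its second variable. -/
noncomputable def profileDeriv (r s : ℝ) : ℝ :=
  1 / (2 * r ^ 3) *
    (-1 + (2 * max (s - r ^ 2) 0 - 2 * max (s - 5 * r ^ 2) 0) / (8 * r ^ 2))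

theorem hasDerivAt_profile (r s : ℝ) : HasDerivAt (profile r) (profileDeriv r s) s := by
  have h (a : ℝ) : HasDerivAt (fun t : ℝ => max (t - a) 0 ^ 2) (2 * max (s - a) 0) s := by
    have := (hasDerivAt_max_zero_sq (s - a)).comp s ((hasDerivAt_id s).sub_const a)
    rw [mul_one] at this
    exact this
  exact (((hasDerivAt_id s).const_sub _).add
    (((h (r ^ 2)).sub (h (5 * r ^ 2))).div_const _)).const_mul _

theorem contDiff_profile (r : ℝ) : ContDiff ℝ 1 (profile r) := by
  rw [contDiff_one_iff_deriv]
  refine ⟨fun s => (hasDerivAt_profile r s).differentiableAt, ?_⟩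
  have : deriv (profile r) = profileDeriv r := funext fun s => (hasDerivAt_profile r s).deriv
  rw [this]
  unfold profileDeriv
  fun_prop

theorem profile_of_le {r s : ℝ} (hs : s ≤ r ^ 2) :
    profile r s = (3 * r ^ 2 - s) / (2 * r ^ 3) := by
  rw [profile, max_eq_right (by linarith), max_eq_right (by nlinarith)]
  ring

theorem profile_of_le_of_le {r s : ℝ} (hr : 0 < r) (hs : r ^ 2 ≤ s) (hs' : s ≤ 5 * r ^ 2) :
    profile r s = (5 * r ^ 2 - s) ^ 2 / (16 * r ^ 5) := by
  rw [profile, max_eq_left (by linarith), max_eq_right (by linarith)]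
  field_simp
  ring

theorem profile_of_ge {r s : ℝ} (hr : 0 < r) (hs : 5 * r ^ 2 ≤ s) : profile r s = 0 := by
  rw [profile, max_eq_left (by nlinarith), max_eq_left (by linarith)]
  field_simp
  ring

theorem abs_profile_sq_mul_le_one {r t : ℝ} (hr : 0 < r) (ht : 0 ≤ t) :
    |profile r (t ^ 2)| * t ≤ 1 := by
  rcases le_total t r with h | h
  · have hs : t ^ 2 ≤ r ^ 2 := by gcongr
    rw [profile_of_le hs, abs_of_nonneg (div_nonneg (by nlinarith) (by positivity)),
      div_mul_eq_mul_div, div_le_one (by positivity)]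
    nlinarith [mul_nonneg (sq_nonneg (t - r)) (by linarith : 0 ≤ t + 2 * r)]
  · have hs : r ^ 2 ≤ t ^ 2 := by gcongr
    rcases le_total (t ^ 2) (5 * r ^ 2) with h' | h'
    · rw [profile_of_le_of_le hr hs h', abs_of_nonneg (by positivity), div_mul_eq_mul_div,
        div_le_one (by positivity)]
      -- `t (5r² - t²)² - 16r⁵ = (t - r)² (t³ + 2t²r - 7tr² - 16r³)`, and the cofactor is negative.
      have hcof : 0 ≤ 16 * r ^ 3 + 7 * t * r ^ 2 - 2 * t ^ 2 * r - t ^ 3 := by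
        have h1 : t * t ^ 2 ≤ t * (5 * r ^ 2) := by gcongr
        have h2 : r * t ^ 2 ≤ r * (5 * r ^ 2) := by gcongr
        have h3 : 0 ≤ t * r ^ 2 := by positivity
        have h4 : 0 ≤ r ^ 3 := by positivity
        nlinarith
      nlinarith [mul_nonneg (sq_nonneg (t - r)) hcof]
    · rw [profile_of_ge hr h']
      simp

/-- The vector field `z(y) = F(|y - c|²) (y - c)` with `F` the function `profile r`. -/
noncomputable def calibration (c : EuclideanSpace ℝ (Fin d)) (r : ℝ)
    (y : EuclideanSpace ℝ (Fin d)) : EuclideanSpace ℝ (Fin d) :=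
  profile r (‖y - c‖ ^ 2) • (y - c)

theorem contDiff_calibration (c : EuclideanSpace ℝ (Fin d)) (r : ℝ) :
    ContDiff ℝ 1 (calibration c r) := by
  have h : ContDiff ℝ 1 (fun y : EuclideanSpace ℝ (Fin d) => y - c) :=
    contDiff_id.sub contDiff_const
  exact ((contDiff_profile r).comp (h.norm_sq ℝ)).smul h

theorem hasCompactSupport_calibration (c : EuclideanSpace ℝ (Fin d)) {r : ℝ} (hr : 0 < r) :
    HasCompactSupport (calibration c r) := by
  refine HasCompactSupport.intro (isCompact_closedBall c (3 * r)) fun y hy => ?_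
  rw [mem_closedBall, dist_eq_norm, not_le] at hy
  rw [calibration, profile_of_ge hr (by nlinarith), zero_smul]

theorem norm_calibration_le_one (c : EuclideanSpace ℝ (Fin d)) {r : ℝ} (hr : 0 < r)
    (y : EuclideanSpace ℝ (Fin d)) : ‖calibration c r y‖ ≤ 1 := by
  rw [calibration, norm_smul, Real.norm_eq_abs]
  exact abs_profile_sq_mul_le_one hr (norm_nonneg _)

theorem div_radial {F : ℝ → ℝ} {F' : ℝ} (c y : EuclideanSpace ℝ (Fin d))
    (hF : HasDerivAt F F' (‖y - c‖ ^ 2)) :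
    div (fun y => F (‖y - c‖ ^ 2) • (y - c)) y =
      d * F (‖y - c‖ ^ 2) + 2 * ‖y - c‖ ^ 2 * F' := by
  have hid : HasFDerivAt (fun y : EuclideanSpace ℝ (Fin d) => y - c)
      (ContinuousLinearMap.id ℝ (EuclideanSpace ℝ (Fin d))) y := (hasFDerivAt_id y).sub_const c
  have h := (hF.comp_hasFDerivAt y hid.norm_sq).smul hid
  unfold div
  have h' : fderiv ℝ (fun y => F (‖y - c‖ ^ 2) • (y - c)) y = _ := h.fderiv
  rw [h']
  simp only [ContinuousLinearMap.comp_id, _root_.add_apply,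
    _root_.smul_apply, ContinuousLinearMap.smulRight_apply, PiLp.add_apply,
    PiLp.smul_apply, ContinuousLinearMap.id_apply, Function.comp_apply, innerSL_apply_apply,
    EuclideanSpace.inner_single_right, EuclideanSpace.norm_sq_eq, smul_eq_mul, Real.norm_eq_abs,
    sq_abs, Finset.sum_add_distrib, Finset.mul_sum, Finset.sum_mul]
  congr 1
  · simp
  · refine Finset.sum_congr rfl fun i _ => ?_
    simp
    ring

/-- The divergence of the calibrating field dominates the quadratic function which it equals on
the ball. Outside the ball the difference comes from the increasing part
`(max (s - r²) 0 ² - max (s - 5r²) 0 ²) / (8r²)` of the profile. -/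
theorem le_div_calibration (c : EuclideanSpace ℝ (Fin d)) {r : ℝ} (hr : 0 < r)
    (y : EuclideanSpace ℝ (Fin d)) :
    1 / (2 * r ^ 3) * (3 * d * r ^ 2 - (d + 2) * ‖y - c‖ ^ 2) ≤ div (calibration c r) y := by
  have h : div (calibration c r) y = _ := div_radial c y (hasDerivAt_profile r _)
  rw [h]
  set s := ‖y - c‖ ^ 2 with hs
  have hs0 : 0 ≤ s := by positivity
  have hm : max (s - 5 * r ^ 2) 0 ≤ max (s - r ^ 2) 0 := max_le_max_right _ (by nlinarith)
  have hm0 : 0 ≤ max (s - 5 * r ^ 2) 0 := le_max_right _ _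
  unfold profile profileDeriv
  set p := max (s - r ^ 2) 0
  set q := max (s - 5 * r ^ 2) 0
  have hpq : 0 ≤ p ^ 2 - q ^ 2 := by nlinarith
  have : d * (1 / (2 * r ^ 3) * (3 * r ^ 2 - s + (p ^ 2 - q ^ 2) / (8 * r ^ 2))) +
        2 * s * (1 / (2 * r ^ 3) * (-1 + (2 * p - 2 * q) / (8 * r ^ 2))) =
      1 / (2 * r ^ 3) * (3 * d * r ^ 2 - (d + 2) * s) +
        1 / (2 * r ^ 3) * (d * ((p ^ 2 - q ^ 2) / (8 * r ^ 2)) +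
          2 * s * (2 * (p - q) / (8 * r ^ 2))) := by ring
  rw [this]
  have hpq' : 0 ≤ p - q := by linarith
  have : 0 ≤ 1 / (2 * r ^ 3) * (d * ((p ^ 2 - q ^ 2) / (8 * r ^ 2)) +
          2 * s * (2 * (p - q) / (8 * r ^ 2))) := by positivity
  linarith

theorem ofReal_integral_div_calibration_le_TV (c : EuclideanSpace ℝ (Fin d)) {r : ℝ} (hr : 0 < r)
    (ρ : Measure (EuclideanSpace ℝ (Fin d))) :
    ENNReal.ofReal (∫ x, div (calibration c r) x ∂ρ) ≤ TV ρ :=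
  le_iSup₂_of_le (f := fun z _ => ENNReal.ofReal (∫ x, div z x ∂ρ)) (calibration c r)
    ⟨contDiff_calibration c r, hasCompactSupport_calibration c hr, norm_calibration_le_one c hr⟩
    le_rfl

/-! ### Transport plans -/

theorem isProbabilityMeasure_of_map_fst {X Y : Type*} [MeasurableSpace X] [MeasurableSpace Y]
    {μ : Measure X} [IsProbabilityMeasure μ] {γ : Measure (X × Y)} (h : γ.map Prod.fst = μ) :
    IsProbabilityMeasure γ := by
  have : IsProbabilityMeasure (γ.map Prod.fst) := h ▸ inferInstance
  exact Measure.isProbabilityMeasure_of_map Prod.fst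

theorem lintegral_enorm_sq_eq_ofReal {X E : Type*} [MeasurableSpace X] [NormedAddCommGroup E]
    {μ : Measure X} {f : X → E} (hf : Integrable (fun x => ‖f x‖ ^ 2) μ) :
    ∫⁻ x, ‖f x‖ₑ ^ 2 ∂μ = ENNReal.ofReal (∫ x, ‖f x‖ ^ 2 ∂μ) := by
  rw [ofReal_integral_eq_lintegral_ofReal hf (ae_of_all _ fun _ => by positivity)]
  simp_rw [ENNReal.ofReal_pow (norm_nonneg _), ofReal_norm]

theorem integrable_norm_sq_of_lintegral_ne_top {X E : Type*} [MeasurableSpace X]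
    [NormedAddCommGroup E] {μ : Measure X} {f : X → E} (hf : AEStronglyMeasurable f μ)
    (h : ∫⁻ x, ‖f x‖ₑ ^ 2 ∂μ ≠ ∞) : Integrable (fun x => ‖f x‖ ^ 2) μ := by
  refine ⟨(hf.norm.pow 2), ?_⟩
  rw [HasFiniteIntegral]
  simpa [enorm_pow] using h.lt_top

/-- If plans between `μ` and `ν` concentrate in mean square on the graph of `T`, then `T`
transports `μ` to `ν`: Markov's inequality shows that the Lévy–Prokhorov distance of the two
measures is zero. -/
theorem map_eq_of_forall_exists_plan {T : EuclideanSpace ℝ (Fin d) → EuclideanSpace ℝ (Fin d)}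
    (hT : Measurable T) (μ ν : Measure (EuclideanSpace ℝ (Fin d))) [IsProbabilityMeasure μ]
    [IsProbabilityMeasure ν]
    (h : ∀ ε : ℝ≥0∞, 0 < ε → ∃ γ : Measure (EuclideanSpace ℝ (Fin d) × EuclideanSpace ℝ (Fin d)),
      (γ.map Prod.fst = μ ∧ γ.map Prod.snd = ν) ∧ ∫⁻ p, ‖p.2 - T p.1‖ₑ ^ 2 ∂γ < ε) :
    μ.map T = ν := by
  have hprob : IsProbabilityMeasure (μ.map T) := Measure.isProbabilityMeasure_map hT.aemeasurable
  have hLP : levyProkhorovEDist (μ.map T) ν ≤ 0 := by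
    refine levyProkhorovEDist_le_of_forall_le _ _ _ fun ε B hε hεt hB => ?_
    -- With mean square deviation below `ε³`, the deviation is at least `ε` with mass at most `ε`.
    obtain ⟨γ, ⟨h1, h2⟩, hγ⟩ := h (ε ^ 2 * ε) (by positivity)
    have hcost : Measurable (fun p : EuclideanSpace ℝ (Fin d) × EuclideanSpace ℝ (Fin d) =>
        ‖p.2 - T p.1‖ₑ ^ 2) :=
      ((measurable_snd.sub (hT.comp measurable_fst)).enorm).pow_const 2
    have hmarkov := mul_meas_ge_le_lintegral (μ := γ) hcost (ε ^ 2)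
    have hsmall : γ {p | ε ^ 2 ≤ ‖p.2 - T p.1‖ₑ ^ 2} ≤ ε :=
      (ENNReal.mul_le_mul_iff_right (by positivity) (ENNReal.pow_ne_top hεt.ne)).1
        (hmarkov.trans hγ.le)
    rw [← h1, ← h2, Measure.map_map hT measurable_fst,
      Measure.map_apply (hT.comp measurable_fst) hB,
      Measure.map_apply measurable_snd isOpen_thickening.measurableSet]
    refine (measure_mono (t := Prod.snd ⁻¹' thickening ε.toReal B ∪
      {p | ε ^ 2 ≤ ‖p.2 - T p.1‖ₑ ^ 2}) fun p hp => ?_).trans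
      ((measure_union_le _ _).trans (add_le_add_right hsmall _))
    by_cases hle : ε ^ 2 ≤ ‖p.2 - T p.1‖ₑ ^ 2
    · exact Or.inr hle
    · refine Or.inl ((mem_thickening_iff_exists_edist_lt _ _).2 ⟨T p.1, hp, ?_⟩)
      rw [ENNReal.ofReal_toReal hεt.ne, edist_eq_enorm_sub]
      contrapose! hle
      gcongr
  have hLP0 := le_antisymm hLP bot_le
  refine ext_of_generate_finite _ ?_ isPiSystem_isClosed (fun A hA => ?_) (by simp)
  · rw [BorelSpace.measurable_eq (α := EuclideanSpace ℝ (Fin d)), borel_eq_generateFrom_isClosed]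
  · exact measure_eq_measure_of_levyProkhorovEDist_eq_zero_of_isClosed hLP0 hA
      ⟨1, one_pos, measure_ne_top _ _⟩ ⟨1, one_pos, measure_ne_top _ _⟩

theorem W2sq_map_le {T : EuclideanSpace ℝ (Fin d) → EuclideanSpace ℝ (Fin d)} (hT : Measurable T)
    (μ : Measure (EuclideanSpace ℝ (Fin d))) :
    W2sq μ (μ.map T) ≤ ∫⁻ x, ‖x - T x‖ₑ ^ 2 ∂μ := by
  have hm : Measurable (fun x => (x, T x)) := measurable_id.prodMk hT
  refine iInf₂_le_of_le (μ.map fun x => (x, T x)) ⟨?_, ?_⟩ ?_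
  · rw [Measure.map_map measurable_fst hm]
    exact Measure.map_id
  · rw [Measure.map_map measurable_snd hm]
    rfl
  · rw [lintegral_map (by fun_prop) hm]

theorem exists_plan_of_energy_lt {τ : ℝ} (hτ : 0 < τ)
    {ρ₀ ρ : Measure (EuclideanSpace ℝ (Fin d))} {a : ℝ≥0∞} (h : energy τ ρ₀ ρ < a) :
    ∃ γ : Measure (EuclideanSpace ℝ (Fin d) × EuclideanSpace ℝ (Fin d)),
      (γ.map Prod.fst = ρ₀ ∧ γ.map Prod.snd = ρ) ∧
      TV ρ + ENNReal.ofReal (1 / (2 * τ)) * ∫⁻ p, ‖p.1 - p.2‖ₑ ^ 2 ∂γ < a := by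
  have hk : ENNReal.ofReal (1 / (2 * τ)) ≠ 0 := by
    rw [Ne, ENNReal.ofReal_eq_zero, not_le]
    positivity
  rw [energy, W2sq] at h
  simp_rw [ENNReal.mul_iInf_of_ne hk ENNReal.ofReal_ne_top, ENNReal.add_iInf, iInf_lt_iff] at h
  obtain ⟨γ, hγ, h⟩ := h
  exact ⟨γ, hγ, h⟩

/-! ### Weak duality and the minimizer -/

/-- The common value of the energy at its minimizer and of the dual bound, for balls of radii
`r₀` and `r₁`: the perimeter-to-volume ratio of the target ball plus the cost of the dilation. -/
noncomputable def minEnergy (d : ℕ) (τ r₀ r₁ : ℝ) : ℝ :=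
  d / r₁ + 1 / (2 * τ) * ((r₁ / r₀ - 1) ^ 2 * (d / (d + 2) * r₀ ^ 2))

theorem minEnergy_nonneg (d : ℕ) {τ r₀ r₁ : ℝ} (hτ : 0 < τ) (h₁ : 0 < r₁) :
    0 ≤ minEnergy d τ r₀ r₁ := by
  unfold minEnergy
  positivity

theorem lintegral_dilation_cost (hd : 1 ≤ d) (c : EuclideanSpace ℝ (Fin d)) {r : ℝ} (hr : 0 < r)
    (l : ℝ) :
    ∫⁻ x, ‖x - (c + l • (x - c))‖ₑ ^ 2 ∂(uniformBall c r) =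
      ENNReal.ofReal ((l - 1) ^ 2 * (d / (d + 2) * r ^ 2)) := by
  have h (x : EuclideanSpace ℝ (Fin d)) :
      ‖x - (c + l • (x - c))‖ ^ 2 = (l - 1) ^ 2 * ‖x - c‖ ^ 2 := by
    rw [show x - (c + l • (x - c)) = (1 - l) • (x - c) by module, norm_smul, mul_pow,
      Real.norm_eq_abs, sq_abs]
    ring
  rw [lintegral_enorm_sq_eq_ofReal, ← integral_uniformBall_norm_sub_sq hd c hr,
    ← integral_const_mul]
  · simp_rw [h]
  · simp_rw [h]
    exact (integrable_uniformBall_norm_sub_sq c hr).const_mul _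

/-- Completing the square in the transport cost, with the quadratic Kantorovich potentials of the
dilation by `r₁ / r₀`; the equation for `r₁` makes the potential in `y` cancel the quadratic part
of the lower bound for the divergence of the calibrating field. -/
theorem le_div_calibration_add_cost (c x y : EuclideanSpace ℝ (Fin d)) {τ r₀ r₁ : ℝ}
    (hτ : 0 < τ) (h₀ : 0 < r₀) (h₁ : 0 < r₁) (h : r₁ ^ 2 * (r₁ - r₀) = ((d : ℝ) + 2) * τ) :
    3 * d / (2 * r₁) + (1 - r₁ / r₀) / (2 * τ) * ‖x - c‖ ^ 2 +
        r₀ / (2 * τ * r₁) * ‖y - (c + (r₁ / r₀) • (x - c))‖ ^ 2 ≤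
      div (calibration c r₁) y + 1 / (2 * τ) * ‖x - y‖ ^ 2 := by
  refine le_trans (le_of_eq ?_) (add_le_add_left (le_div_calibration c h₁ y) _)
  have e1 : x - y = (x - c) - (y - c) := by abel
  have e2 : y - (c + (r₁ / r₀) • (x - c)) = (y - c) - (r₁ / r₀) • (x - c) := by abel
  rw [e1, e2, norm_sub_sq_real (x - c), norm_sub_sq_real (y - c), norm_smul, inner_smul_right,
    real_inner_comm (x - c) (y - c), Real.norm_of_nonneg (by positivity)]
  set u := ‖x - c‖
  set v := ‖y - c‖
  set w := inner ℝ (y - c) (x - c)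
  have hd2 : (d : ℝ) = r₁ ^ 2 * (r₁ - r₀) / τ - 2 := by
    field_simp
    linarith
  rw [hd2]
  field_simp
  ring

/-- Weak duality, keeping on the left the mean square deviation of the plan from the graph of the
dilation. Applied to plans between the two balls it gives minimality, applied to almost optimal
plans of another minimizer it gives uniqueness. -/
theorem minEnergy_add_deviation_le (hd : 1 ≤ d) (c : EuclideanSpace ℝ (Fin d)) {τ r₀ r₁ : ℝ}
    (hτ : 0 < τ) (h₀ : 0 < r₀) (h₁ : 0 < r₁) (h : r₁ ^ 2 * (r₁ - r₀) = ((d : ℝ) + 2) * τ)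
    {σ : Measure (EuclideanSpace ℝ (Fin d))}
    {γ : Measure (EuclideanSpace ℝ (Fin d) × EuclideanSpace ℝ (Fin d))}
    (hfst : γ.map Prod.fst = uniformBall c r₀) (hsnd : γ.map Prod.snd = σ) :
    ENNReal.ofReal (minEnergy d τ r₀ r₁) + ENNReal.ofReal (r₀ / (2 * τ * r₁)) *
        ∫⁻ p, ‖p.2 - (c + (r₁ / r₀) • (p.1 - c))‖ₑ ^ 2 ∂γ ≤
      TV σ + ENNReal.ofReal (1 / (2 * τ)) * ∫⁻ p, ‖p.1 - p.2‖ₑ ^ 2 ∂γ := by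
  have hprob₀ := isProbabilityMeasure_uniformBall c h₀
  have hprob : IsProbabilityMeasure γ := isProbabilityMeasure_of_map_fst hfst
  by_cases htop : ∫⁻ p, ‖p.1 - p.2‖ₑ ^ 2 ∂γ = ∞
  · rw [htop, ENNReal.mul_top, add_top]
    · exact le_top
    · rw [Ne, ENNReal.ofReal_eq_zero, not_le]
      positivity
  have hcost : Integrable (fun p => ‖p.1 - p.2‖ ^ 2) γ :=
    integrable_norm_sq_of_lintegral_ne_top (by fun_prop) htop
  have hcont : Continuous (fun x : EuclideanSpace ℝ (Fin d) => ‖x - c‖ ^ 2) := by fun_prop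
  have hfstint : Integrable (fun p => ‖p.1 - c‖ ^ 2) γ := by
    have := integrable_uniformBall_norm_sub_sq c h₀
    rw [← hfst] at this
    exact this.comp_measurable measurable_fst
  have hfstval : ∫ p, ‖p.1 - c‖ ^ 2 ∂γ = d / (d + 2) * r₀ ^ 2 := by
    rw [← integral_uniformBall_norm_sub_sq hd c h₀, ← hfst,
      integral_map measurable_fst.aemeasurable hcont.aestronglyMeasurable]
  have hdev : Integrable (fun p => ‖p.2 - (c + (r₁ / r₀) • (p.1 - c))‖ ^ 2) γ := by
    refine Integrable.mono' ((hcost.const_mul 2).add (hfstint.const_mul (2 * (r₁ / r₀ - 1) ^ 2)))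
      (by fun_prop) (ae_of_all _ fun p => ?_)
    rw [Real.norm_of_nonneg (by positivity)]
    have e : p.2 - (c + (r₁ / r₀) • (p.1 - c)) = -((p.1 - p.2) + (r₁ / r₀ - 1) • (p.1 - c)) := by
      module
    have hs : ‖(r₁ / r₀ - 1) • (p.1 - c)‖ ^ 2 = (r₁ / r₀ - 1) ^ 2 * ‖p.1 - c‖ ^ 2 := by
      rw [norm_smul, mul_pow, Real.norm_eq_abs, sq_abs]
    rw [e, norm_neg]
    change _ ≤ 2 * ‖p.1 - p.2‖ ^ 2 + 2 * (r₁ / r₀ - 1) ^ 2 * ‖p.1 - c‖ ^ 2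
    have htri := norm_add_le (p.1 - p.2) ((r₁ / r₀ - 1) • (p.1 - c))
    rw [mul_assoc, ← hs]
    nlinarith [norm_nonneg ((p.1 - p.2) + (r₁ / r₀ - 1) • (p.1 - c)),
      sq_nonneg (‖p.1 - p.2‖ - ‖(r₁ / r₀ - 1) • (p.1 - c)‖)]
  have hdivcont := continuous_div (contDiff_calibration c r₁)
  have hdivint : Integrable (fun p => div (calibration c r₁) p.2) γ := by
    have hσ : IsProbabilityMeasure (γ.map Prod.snd) :=
      Measure.isProbabilityMeasure_map measurable_snd.aemeasurable
    exact (integrable_div (contDiff_calibration c r₁) (hasCompactSupport_calibration c h₁)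
      (γ.map Prod.snd)).comp_measurable measurable_snd
  have hdivval : ∫ p, div (calibration c r₁) p.2 ∂γ = ∫ y, div (calibration c r₁) y ∂σ := by
    rw [← hsnd, integral_map measurable_snd.aemeasurable hdivcont.aestronglyMeasurable]
  have hkey : minEnergy d τ r₀ r₁ + r₀ / (2 * τ * r₁) *
        ∫ p, ‖p.2 - (c + (r₁ / r₀) • (p.1 - c))‖ ^ 2 ∂γ ≤
      ∫ y, div (calibration c r₁) y ∂σ + 1 / (2 * τ) * ∫ p, ‖p.1 - p.2‖ ^ 2 ∂γ := by
    have hconst : Integrable (fun p : EuclideanSpace ℝ (Fin d) × EuclideanSpace ℝ (Fin d) =>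
        3 * d / (2 * r₁) + (1 - r₁ / r₀) / (2 * τ) * ‖p.1 - c‖ ^ 2) γ :=
      (integrable_const _).add (hfstint.const_mul _)
    have hmono := integral_mono (hconst.add (hdev.const_mul (r₀ / (2 * τ * r₁))))
      (hdivint.add (hcost.const_mul (1 / (2 * τ))))
      fun p => le_div_calibration_add_cost c p.1 p.2 hτ h₀ h₁ h
    rw [integral_add' hconst (hdev.const_mul _), integral_add' hdivint (hcost.const_mul _),
      integral_add (integrable_const _) (hfstint.const_mul _), integral_const_mul,
      integral_const_mul, integral_const_mul, hfstval, hdivval, integral_const, probReal_univ,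
      one_smul] at hmono
    have hval : minEnergy d τ r₀ r₁ =
        3 * d / (2 * r₁) + (1 - r₁ / r₀) / (2 * τ) * (d / (d + 2) * r₀ ^ 2) := by
      have hτ' : τ = r₁ ^ 2 * (r₁ - r₀) / (d + 2) := by
        field_simp
        linarith
      have hne : r₁ - r₀ ≠ 0 := by
        intro h0
        rw [h0, mul_zero] at h
        have : 0 < ((d : ℝ) + 2) * τ := by positivity
        linarith
      rw [minEnergy, hτ']
      field_simp
      ring
    rw [hval]
    exact hmono
  rw [lintegral_enorm_sq_eq_ofReal hcost, lintegral_enorm_sq_eq_ofReal hdev,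
    ← ENNReal.ofReal_mul (by positivity), ← ENNReal.ofReal_mul (by positivity),
    ← ENNReal.ofReal_add (minEnergy_nonneg d hτ h₁)
      (mul_nonneg (by positivity) (integral_nonneg fun _ => by positivity))]
  exact (ENNReal.ofReal_le_ofReal hkey).trans (ENNReal.ofReal_add_le.trans
    (add_le_add_left (ofReal_integral_div_calibration_le_TV c h₁ σ) _))

theorem minEnergy_le_energy (hd : 1 ≤ d) (c : EuclideanSpace ℝ (Fin d)) {τ r₀ r₁ : ℝ}
    (hτ : 0 < τ) (h₀ : 0 < r₀) (h₁ : 0 < r₁) (h : r₁ ^ 2 * (r₁ - r₀) = ((d : ℝ) + 2) * τ)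
    (σ : Measure (EuclideanSpace ℝ (Fin d))) :
    ENNReal.ofReal (minEnergy d τ r₀ r₁) ≤ energy τ (uniformBall c r₀) σ := by
  by_contra! hlt
  obtain ⟨γ, ⟨hfst, hsnd⟩, hγ⟩ := exists_plan_of_energy_lt hτ hlt
  exact absurd (le_self_add.trans (minEnergy_add_deviation_le hd c hτ h₀ h₁ h hfst hsnd)) hγ.not_ge

theorem W2sq_uniformBall_le (hd : 1 ≤ d) (c : EuclideanSpace ℝ (Fin d)) {r₀ r₁ : ℝ}
    (h₀ : 0 < r₀) (h₁ : 0 < r₁) :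
    W2sq (uniformBall c r₀) (uniformBall c r₁) ≤
      ENNReal.ofReal ((r₁ / r₀ - 1) ^ 2 * (d / (d + 2) * r₀ ^ 2)) := by
  rw [← lintegral_dilation_cost hd c h₀, ← map_dilation_uniformBall c h₀ h₁]
  exact W2sq_map_le (by fun_prop) _

theorem energy_uniformBall (hd : 1 ≤ d) (c : EuclideanSpace ℝ (Fin d)) {τ r₀ r₁ : ℝ}
    (hτ : 0 < τ) (h₀ : 0 < r₀) (h₁ : 0 < r₁) (h : r₁ ^ 2 * (r₁ - r₀) = ((d : ℝ) + 2) * τ) :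
    energy τ (uniformBall c r₀) (uniformBall c r₁) = ENNReal.ofReal (minEnergy d τ r₀ r₁) := by
  refine le_antisymm ?_ (minEnergy_le_energy hd c hτ h₀ h₁ h _)
  rw [energy, minEnergy, ENNReal.ofReal_add (by positivity) (by positivity),
    ENNReal.ofReal_mul (by positivity)]
  exact add_le_add (TV_uniformBall_le c h₁) (mul_le_mul_right (W2sq_uniformBall_le hd c h₀ h₁) _)

theorem W2sq_uniformBall (hd : 1 ≤ d) (c : EuclideanSpace ℝ (Fin d)) {τ r₀ r₁ : ℝ}
    (hτ : 0 < τ) (h₀ : 0 < r₀) (h₁ : 0 < r₁) (h : r₁ ^ 2 * (r₁ - r₀) = ((d : ℝ) + 2) * τ) :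
    W2sq (uniformBall c r₀) (uniformBall c r₁) =
      ENNReal.ofReal ((r₁ / r₀ - 1) ^ 2 * (d / (d + 2) * r₀ ^ 2)) := by
  refine le_antisymm (W2sq_uniformBall_le hd c h₀ h₁) ?_
  -- The total variation term of the minimal energy is at most `d / r₁`, so the transport term
  -- accounts for the rest.
  have hE := (minEnergy_le_energy hd c hτ h₀ h₁ h (uniformBall c r₁)).trans
    (add_le_add_left (TV_uniformBall_le c h₁) _)
  rw [minEnergy, ENNReal.ofReal_add (by positivity) (by positivity),
    ENNReal.ofReal_mul (by positivity),
    ENNReal.add_le_add_iff_left ENNReal.ofReal_ne_top] at hE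
  refine (ENNReal.mul_le_mul_iff_right ?_ ENNReal.ofReal_ne_top).1 hE
  rw [Ne, ENNReal.ofReal_eq_zero, not_le]
  positivity

theorem eq_uniformBall_of_energy_le (hd : 1 ≤ d) (c : EuclideanSpace ℝ (Fin d)) {τ r₀ r₁ : ℝ}
    (hτ : 0 < τ) (h₀ : 0 < r₀) (h₁ : 0 < r₁) (h : r₁ ^ 2 * (r₁ - r₀) = ((d : ℝ) + 2) * τ)
    {σ : Measure (EuclideanSpace ℝ (Fin d))} [IsProbabilityMeasure σ]
    (hσ : energy τ (uniformBall c r₀) σ ≤ ENNReal.ofReal (minEnergy d τ r₀ r₁)) :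
    σ = uniformBall c r₁ := by
  have hprob₀ := isProbabilityMeasure_uniformBall c h₀
  rw [← map_dilation_uniformBall c h₀ h₁]
  refine (map_eq_of_forall_exists_plan (by fun_prop) _ _ fun ε hε => ?_).symm
  set k := ENNReal.ofReal (r₀ / (2 * τ * r₁)) with hk
  have hk0 : k ≠ 0 := by
    rw [hk, Ne, ENNReal.ofReal_eq_zero, not_le]
    positivity
  have hlt : energy τ (uniformBall c r₀) σ < ENNReal.ofReal (minEnergy d τ r₀ r₁) + k * ε :=
    hσ.trans_lt (ENNReal.lt_add_right ENNReal.ofReal_ne_top (mul_ne_zero hk0 hε.ne'))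
  obtain ⟨γ, ⟨hfst, hsnd⟩, hγ⟩ := exists_plan_of_energy_lt hτ hlt
  refine ⟨γ, ⟨hfst, hsnd⟩, ?_⟩
  have := (minEnergy_add_deviation_le hd c hτ h₀ h₁ h hfst hsnd).trans_lt hγ
  rw [ENNReal.add_lt_add_iff_left ENNReal.ofReal_ne_top] at this
  exact lt_of_mul_lt_mul_left' this

theorem exists_unique_radius {r₀ K : ℝ} (h₀ : 0 < r₀) (hK : 0 < K) :
    ∃ r₁ : ℝ, ∀ r : ℝ, (0 < r ∧ r ^ 2 * (r - r₀) = K) ↔ r = r₁ := by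
  have hmem : K ∈ Icc (r₀ ^ 2 * (r₀ - r₀)) ((r₀ + 1 + K / r₀ ^ 2) ^ 2 *
      ((r₀ + 1 + K / r₀ ^ 2) - r₀)) := by
    refine ⟨by simpa using hK.le, ?_⟩
    have hq : 0 < K / r₀ ^ 2 := by positivity
    have h1 : r₀ ^ 2 ≤ (r₀ + 1 + K / r₀ ^ 2) ^ 2 := by gcongr; linarith
    calc K = r₀ ^ 2 * (K / r₀ ^ 2) := by field_simp
      _ ≤ _ := by gcongr; linarith
  have hle : r₀ ≤ r₀ + 1 + K / r₀ ^ 2 := by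
    have hq : 0 < K / r₀ ^ 2 := by positivity
    linarith
  obtain ⟨r₁, ⟨hr₁, -⟩, h₁⟩ :=
    intermediate_value_Icc hle (f := fun r : ℝ => r ^ 2 * (r - r₀)) (by fun_prop) hmem
  have h₁ : r₁ ^ 2 * (r₁ - r₀) = K := h₁
  have hpos : 0 < r₁ := h₀.trans_le hr₁
  have hgt (r : ℝ) (h : r ^ 2 * (r - r₀) = K) : 0 < r - r₀ :=
    pos_of_mul_pos_right (h ▸ hK) (sq_nonneg r)
  refine ⟨r₁, fun r => ⟨fun ⟨hr, h⟩ => ?_, fun h => h ▸ ⟨hpos, h₁⟩⟩⟩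
  have hstrict {a b : ℝ} (ha : 0 < a) (hab : a < b) (ha' : 0 < a - r₀) :
      a ^ 2 * (a - r₀) < b ^ 2 * (b - r₀) := by gcongr
  rcases lt_trichotomy r r₁ with hlt | heq | hlt
  · linarith [hstrict hr hlt (hgt r h)]
  · exact heq
  · linarith [hstrict hpos hlt (hgt r₁ h₁)]

end TVWasserstein

theorem mainTheorem4 (d : ℕ) (hd : 1 ≤ d) (c : EuclideanSpace ℝ (Fin d)) (r₀ τ : ℝ)
    (hr₀ : 0 < r₀) (hτ : 0 < τ) :
    ∃ r₁ : ℝ,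
      (∀ r : ℝ, (0 < r ∧ r ^ 2 * (r - r₀) = ((d : ℝ) + 2) * τ) ↔ r = r₁) ∧
      (∀ ρ : Measure (EuclideanSpace ℝ (Fin d)),
        TVWasserstein.IsMinimizer τ (TVWasserstein.uniformBall c r₀) ρ ↔
          ρ = TVWasserstein.uniformBall c r₁) ∧
      (TVWasserstein.uniformBall c r₀).map (fun x => c + (r₁ / r₀) • (x - c)) =
        TVWasserstein.uniformBall c r₁ ∧
      TVWasserstein.W2sq (TVWasserstein.uniformBall c r₀) (TVWasserstein.uniformBall c r₁) =
        ∫⁻ x, ‖x - (c + (r₁ / r₀) • (x - c))‖ₑ ^ 2 ∂(TVWasserstein.uniformBall c r₀) := by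
  obtain ⟨r₁, hiff⟩ := TVWasserstein.exists_unique_radius (K := ((d : ℝ) + 2) * τ) hr₀
    (by positivity)
  obtain ⟨h₁, h⟩ := (hiff r₁).2 rfl
  have hprob := TVWasserstein.isProbabilityMeasure_uniformBall c h₁
  have henergy := TVWasserstein.energy_uniformBall hd c hτ hr₀ h₁ h
  refine ⟨r₁, hiff, fun ρ => ⟨fun hρ => ?_, ?_⟩,
    TVWasserstein.map_dilation_uniformBall c hr₀ h₁, ?_⟩
  · have := hρ.1
    exact TVWasserstein.eq_uniformBall_of_energy_le hd c hτ hr₀ h₁ h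
      (henergy ▸ hρ.2 _ hprob)
  · rintro rfl
    exact ⟨hprob, fun σ _ => henergy ▸
      TVWasserstein.minEnergy_le_energy hd c hτ hr₀ h₁ h σ⟩
  · rw [TVWasserstein.W2sq_uniformBall hd c hτ hr₀ h₁ h,
      TVWasserstein.lintegral_dilation_cost hd c hr₀]
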